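/- Let $d\ge 2$. For $N\in\mathbb N$ let $$\Gamma(N,d)=\Big\{\mathbf k\in\mathbb Z^d:\ \prod_{j=1}^d\max(|k_j|,1)\le N\Big\}$$ be the hyperbolic cross, $|\Gamma(N,d)|$ its cardinality, and let $\mathcal T(N,d)$ be the space of trigonometric polynomials $\sum_{\mathbf k\in\Gamma(N,d)}c_{\mathbf k}e^{2\pi i(\mathbf k,\mathbf x)}$ with complex coefficients. For $m\in\mathbb N$, $m\ge 1$, and $\mathbf a\in\mathbb Z^d$ put $$\mathbf y^\mu=\Big(\Big\{\frac{\mu a_1}{m}\Big\},\dots,\Big\{\frac{\mu a_d}{m}\Big\}\Big),\qquad \mathcal K_m(\mathbf a)=\{\mathbf y^\mu:\ \mu=1,\dots,m\},\qquad P_m(f,\mathbf a)=\frac1m\sum_{\mu=1}^m f(\mathbf y^\mu),$$ where $\{t\}$ is the fractional part of $t$. The formula $P_m(\cdot,\mathbf a)$ is called exact on $\mathcal T(N,d)$ if $P_m(f,\mathbf a)=\int_{[0,1)^d}f(\mathbf x)\,d\mathbf x$ for all $f\in\mathcal T(N,d)$. For $T\subset[0,1)^d$ the dispersion $\operatorname{disp}(T)$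 is the supremum of the volumes of those boxes $\prod_{j=1}^d[x_j,y_j)$ with $\mathbf x,\mathbf y\in[0,1)^d$, $x_j<y_j$ for all $j$, that contain no point of $T$. There is a constant $C_1(d)>0$, depending only on $d$, such that (i) for all integers $L\ge 2$ and $m\ge1$ and all $\mathbf a\in\mathbb Z^d$ for which $P_m(\cdot,\mathbf a)$ is exact on $\mathcal T(L,d)$, $$\operatorname{disp}(\mathcal K_m(\mathbf a))\le C_1(d)L^{-1};$$ (ii) with this same constant $C_1(d)$, there is a constant $C_2(d)>0$, depending only on $d$, with the following property. For every integer $L\ge2$ there exist a prime number $m\le C_2(d)\,|\Gamma(L,d)|$ and a natural number $a\in[1,m)$ such that $$\operatorname{disp}\big(\mathcal K_m(1,a,a^2,\dots,a^{d-1})\big)\le C_1(d)L^{-1}.$$ -/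

import Mathlib

noncomputable section

namespace Korobov

/-- The half-open unit cube `[0,1)^d`. -/
def unitCube (d : ℕ) : Set (Fin d → ℝ) :=
  Set.univ.pi fun _ => Set.Ico (0 : ℝ) 1

/-- The half-open axis-parallel box `[x,y) = [x_1,y_1) × ⋯ × [x_d,y_d)`. -/
def box {d : ℕ} (x y : Fin d → ℝ) : Set (Fin d → ℝ) :=
  Set.univ.pi fun j => Set.Ico (x j) (y j)

/-- The family of all boxes `[x,y)` with `x, y ∈ [0,1)^d` and `x < y` in every coordinate. -/
def boxes (d : ℕ) : Set (Set (Fin d → ℝ)) :=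
  {B | ∃ x ∈ unitCube d, ∃ y ∈ unitCube d, (∀ j, x j < y j) ∧ B = box x y}

/-- The set of volumes of the boxes that contain no point of `T`. -/
def emptyBoxVolumes {d : ℕ} (T : Set (Fin d → ℝ)) : Set ℝ :=
  {v | ∃ B ∈ boxes d, B ∩ T = ∅ ∧ v = (MeasureTheory.volume B).toReal}

/-- The dispersion of `T`: the supremum of the volumes of the boxes that contain no point
of `T`. -/
def disp {d : ℕ} (T : Set (Fin d → ℝ)) : ℝ :=
  sSup (emptyBoxVolumes T)

/-- The supremum in the definition of `disp` is that of a set bounded above by `1`. -/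
theorem emptyBoxVolumes_bddAbove {d : ℕ} (T : Set (Fin d → ℝ)) :
    BddAbove (emptyBoxVolumes T) := by
  refine ⟨1, ?_⟩
  rintro v ⟨B, ⟨x, hx, y, hy, hxy, rfl⟩, -, rfl⟩
  rw [box, MeasureTheory.volume_pi_pi, ENNReal.toReal_prod]
  refine Finset.prod_le_one (fun _ _ => ENNReal.toReal_nonneg) (fun j _ => ?_)
  have h1 := (hx j (Set.mem_univ j)).1
  have h2 := (hy j (Set.mem_univ j)).2
  rw [Real.volume_Ico, ENNReal.toReal_ofReal (by linarith [hxy j])]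
  linarith

/-- The point `y^μ = ({μ a_1 / m}, …, {μ a_d / m})`. -/
def point {d : ℕ} (m : ℕ) (a : Fin d → ℤ) (μ : ℕ) : Fin d → ℝ :=
  fun j => Int.fract ((μ : ℝ) * (a j : ℝ) / (m : ℝ))

/-- The Korobov point set `K_m(a) = {y^μ : μ = 1, …, m}`. -/
def pointSet {d : ℕ} (m : ℕ) (a : Fin d → ℤ) : Set (Fin d → ℝ) :=
  {p | ∃ μ : ℕ, 1 ≤ μ ∧ μ ≤ m ∧ p = point m a μ}

/-- The vector `(1, a, a², …, a^{d-1})`. -/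
def powers (d : ℕ) (a : ℕ) : Fin d → ℤ :=
  fun j => (a : ℤ) ^ (j : ℕ)

/-- The Korobov cubature formula `P_m(f,a) = m⁻¹ ∑_{μ=1}^m f(y^μ)`. -/
def cubature {d : ℕ} (m : ℕ) (a : Fin d → ℤ) (f : (Fin d → ℝ) → ℂ) : ℂ :=
  (m : ℂ)⁻¹ * ∑ μ ∈ Finset.Icc 1 m, f (point m a μ)

/-- The exponential `x ↦ e^{2πi(k,x)}`. -/
def expo {d : ℕ} (k : Fin d → ℤ) (x : Fin d → ℝ) : ℂ :=
  Complex.exp (2 * (Real.pi : ℂ) * Complex.I * ((∑ j, (k j : ℝ) * x j : ℝ) : ℂ))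

/-- The Fourier coefficient `f̂(k) = ∫_{[0,1)^d} f(x) e^{-2πi(k,x)} dx`. -/
def fourierCoefficient {d : ℕ} (f : (Fin d → ℝ) → ℂ) (k : Fin d → ℤ) : ℂ :=
  ∫ x in unitCube d, f x * expo (-k) x

/-- The hyperbolic cross `Γ(N,d) = {k ∈ ℤ^d : ∏_j max(|k_j|,1) ≤ N}`. -/
def hyperbolicCross (N d : ℕ) : Set (Fin d → ℤ) :=
  {k | ∏ j, max |k j| 1 ≤ (N : ℤ)}

theorem hyperbolicCross_finite (N d : ℕ) : (hyperbolicCross N d).Finite := by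
  refine Set.Finite.subset
    (Set.Finite.pi' (fun _ : Fin d => Set.finite_Icc (-(N : ℤ)) (N : ℤ))) ?_
  intro k hk j
  have h1 : max |k j| 1 ≤ ∏ i, max |k i| 1 := by
    rw [← Finset.mul_prod_erase Finset.univ (fun i => max |k i| 1) (Finset.mem_univ j)]
    refine le_mul_of_one_le_right (le_trans zero_le_one (le_max_right _ _)) ?_
    have h2 : ∏ i ∈ Finset.univ.erase j, (1 : ℤ) ≤
        ∏ i ∈ Finset.univ.erase j, max |k i| 1 :=
      Finset.prod_le_prod (fun _ _ => zero_le_one) (fun i _ => le_max_right _ _)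
    simpa using h2
  exact abs_le.mp ((le_max_left _ _).trans (h1.trans hk))

/-- The space `T(N,d)` of trigonometric polynomials `∑_{k ∈ Γ(N,d)} c_k e^{2πi(k,x)}`. -/
def trigPolys (N d : ℕ) : Set ((Fin d → ℝ) → ℂ) :=
  {f | ∃ c : (Fin d → ℤ) → ℂ,
    f = fun x => ∑ k ∈ (hyperbolicCross_finite N d).toFinset, c k * expo k x}

/-- The Korobov cubature formula `P_m(·,a)` is exact on `T(N,d)`. -/
def IsExact {d : ℕ} (m : ℕ) (a : Fin d → ℤ) (N : ℕ) : Prop :=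
  ∀ f ∈ trigPolys N d, cubature m a f = fourierCoefficient f 0

end Korobov

end

namespace Korobov

open Finset

/-! Exactness is used only through `DualFree`, and then a second-moment argument applies. Let an
empty box have sides u_j and centre z. Give each node the nonnegative weight ∏ |T_j(t_j - z_j)|²,
where T_j has M_j consecutive frequencies and ∏ M_j ≤ L. Frequency differences lie in the hyperbolic
cross, so Parseval holds on the nodes (`sum_prod_normSq_trigSum`). Multiplying T_i by e^{2πit} - 1
differences its coefficients. For the coefficients l(M - l) the weighted mean of |e^{2πi(t_i - z_i)}
- 1|² is therefore at most 10/M_i². Every node leaves the box in some coordinate i, where this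
quantity is at least 4u_i². If M_j u_j ≥ 2d for all j, summing over i gives 1 ≤ 10/(16d), which is
absurd (`exists_point_mem_box`). A volume above (3d)^d/L leaves room for such M_j. For (ii), each
nonzero k of the cross excludes at most d - 1 multipliers modulo p, so a prime of size about d|Γ|
has an admissible one. -/

/-- The character `t ↦ e^{2πit}` of the real line. -/
noncomputable def unitExp (t : ℝ) : ℂ :=
  Complex.exp (2 * (Real.pi : ℂ) * Complex.I * (t : ℂ))

/-! ### Algebra of the character -/

theorem unitExp_add (s t : ℝ) : unitExp (s + t) = unitExp s * unitExp t := by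
  simp only [unitExp, ← Complex.exp_add]
  congr 1
  push_cast
  ring

theorem unitExp_zero : unitExp 0 = 1 := by simp [unitExp]

theorem unitExp_sum {ι : Type*} (s : Finset ι) (f : ι → ℝ) :
    unitExp (∑ i ∈ s, f i) = ∏ i ∈ s, unitExp (f i) := by
  simp only [unitExp, ← Complex.exp_sum]
  congr 1
  push_cast
  rw [Finset.mul_sum]

theorem unitExp_int (n : ℤ) : unitExp n = 1 := by
  rw [unitExp, Complex.exp_eq_one_iff]
  exact ⟨n, by push_cast; ring⟩

theorem unitExp_eq_one_iff (t : ℝ) : unitExp t = 1 ↔ ∃ n : ℤ, t = n := by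
  constructor
  · intro h
    rw [unitExp, Complex.exp_eq_one_iff] at h
    obtain ⟨n, hn⟩ := h
    refine ⟨n, ?_⟩
    have h2 : (2 * (Real.pi : ℂ) * Complex.I) ≠ 0 := Complex.two_pi_I_ne_zero
    have h3 : (t : ℂ) = n := mul_left_cancel₀ h2 (by rw [hn]; ring)
    exact_mod_cast h3
  · rintro ⟨n, rfl⟩
    exact unitExp_int n

theorem unitExp_nat_mul (n : ℕ) (t : ℝ) : unitExp (n * t) = unitExp t ^ n := by
  rw [unitExp, unitExp, ← Complex.exp_nat_mul]
  congr 1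
  push_cast
  ring

theorem conj_unitExp (t : ℝ) : (starRingEnd ℂ) (unitExp t) = unitExp (-t) := by
  rw [unitExp, unitExp, ← Complex.exp_conj]
  congr 1
  simp [Complex.conj_ofNat]

theorem normSq_unitExp (t : ℝ) : Complex.normSq (unitExp t) = 1 := by
  have h : ((Complex.normSq (unitExp t) : ℝ) : ℂ) = 1 := by
    rw [← Complex.mul_conj, conj_unitExp, ← unitExp_add, add_neg_cancel, unitExp_zero]
  exact_mod_cast h

theorem normSq_unitExp_sub_one (t : ℝ) :
    Complex.normSq (unitExp t - 1) = 4 * Real.sin (Real.pi * t) ^ 2 := by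
  have h : unitExp t = ⟨Real.cos (2 * (Real.pi * t)), Real.sin (2 * (Real.pi * t))⟩ := by
    rw [unitExp, show 2 * (Real.pi : ℂ) * Complex.I * (t : ℂ) =
      ((2 * (Real.pi * t) : ℝ) : ℂ) * Complex.I by push_cast; ring]
    apply Complex.ext
    · exact Complex.exp_ofReal_mul_I_re _
    · exact Complex.exp_ofReal_mul_I_im _
  rw [h, Complex.normSq_apply]
  simp only [Complex.sub_re, Complex.sub_im, Complex.one_re, Complex.one_im]
  have h1 := Real.sin_sq_add_cos_sq (2 * (Real.pi * t))
  have h2 := Real.cos_sq_add_sin_sq (Real.pi * t)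
  have h3 := Real.cos_two_mul (Real.pi * t)
  nlinarith

/-! ### Orthogonality of exponentials on the nodes -/

theorem expo_eq_unitExp {d : ℕ} (k : Fin d → ℤ) (x : Fin d → ℝ) :
    expo k x = unitExp (∑ j, (k j : ℝ) * x j) := rfl

theorem expo_eq_prod {d : ℕ} (k : Fin d → ℤ) (x : Fin d → ℝ) :
    expo k x = ∏ j, unitExp ((k j : ℝ) * x j) := by
  rw [expo_eq_unitExp, unitExp_sum]

theorem expo_mul_conj {d : ℕ} (k l : Fin d → ℤ) (x : Fin d → ℝ) :
    expo k x * (starRingEnd ℂ) (expo l x) = expo (k - l) x := by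
  rw [expo_eq_unitExp, expo_eq_unitExp, conj_unitExp, ← unitExp_add, expo_eq_unitExp]
  congr 1
  simp only [Pi.sub_apply, Int.cast_sub, sub_mul, Finset.sum_sub_distrib]
  ring

/-- On the nodes the fractional parts are irrelevant. -/
theorem expo_point {d : ℕ} (m : ℕ) (a k : Fin d → ℤ) (μ : ℕ) :
    expo k (point m a μ) = unitExp (((∑ j, k j * a j : ℤ) : ℝ) / m) ^ μ := by
  rw [expo_eq_prod, ← unitExp_nat_mul, Int.cast_sum, Finset.sum_div, Finset.mul_sum, unitExp_sum]
  refine Finset.prod_congr rfl fun j _ => ?_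
  have h : (μ : ℝ) * (((k j * a j : ℤ) : ℝ) / m) =
      (k j : ℝ) * point m a μ j + ((k j * ⌊(μ : ℝ) * (a j : ℝ) / (m : ℝ)⌋ : ℤ) : ℝ) := by
    have h1 := Int.fract_add_floor ((μ : ℝ) * (a j : ℝ) / (m : ℝ))
    rw [point]
    push_cast
    rw [← mul_add, h1]
    ring
  rw [h, unitExp_add, unitExp_int, mul_one]

theorem sum_expo_point_of_dvd {d : ℕ} (m : ℕ) (hm : 1 ≤ m) (a k : Fin d → ℤ)
    (h : (m : ℤ) ∣ ∑ j, k j * a j) :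
    ∑ μ ∈ Finset.Icc 1 m, expo k (point m a μ) = m := by
  obtain ⟨q, hq⟩ := h
  have hm0 : (m : ℝ) ≠ 0 := by positivity
  have : ((∑ j, k j * a j : ℤ) : ℝ) / m = q := by
    rw [hq]; push_cast; field_simp
  simp only [expo_point, this, unitExp_int, one_pow, Finset.sum_const, Nat.card_Icc]
  simp

theorem sum_expo_point_of_not_dvd {d : ℕ} (m : ℕ) (hm : 1 ≤ m) (a k : Fin d → ℤ)
    (h : ¬ (m : ℤ) ∣ ∑ j, k j * a j) :
    ∑ μ ∈ Finset.Icc 1 m, expo k (point m a μ) = 0 := by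
  have hm0 : (m : ℝ) ≠ 0 := by positivity
  simp only [expo_point]
  set s : ℤ := ∑ j, k j * a j
  set ζ := unitExp ((s : ℝ) / m) with hζ
  have hne : ζ ≠ 1 := by
    rw [hζ, Ne, unitExp_eq_one_iff]
    rintro ⟨n, hn⟩
    apply h
    refine ⟨n, ?_⟩
    rw [div_eq_iff hm0] at hn
    have : (s : ℝ) = ((m * n : ℤ) : ℝ) := by rw [hn]; push_cast; ring
    exact_mod_cast this
  have hpow : ζ ^ m = 1 := by
    rw [hζ, ← unitExp_nat_mul, mul_div_cancel₀ _ hm0, unitExp_int]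
  have h1 : ∑ μ ∈ Finset.Icc 1 m, ζ ^ μ = ζ * ∑ μ ∈ Finset.range m, ζ ^ μ := by
    rw [Finset.mul_sum, Finset.range_eq_Ico]
    have := Finset.sum_Ico_add' (fun μ => ζ ^ μ) 0 m 1
    rw [zero_add] at this
    rw [show Finset.Icc 1 m = Finset.Ico 1 (m + 1) by ext; simp, ← this]
    exact Finset.sum_congr rfl fun i _ => by rw [pow_succ']
  rw [h1, geom_sum_eq hne, hpow]
  simp

/-- Parseval's identity on the nodes, for frequencies that are distinct modulo the dual lattice. -/
theorem sum_normSq_expo_point {d : ℕ} {ι : Type*} [DecidableEq ι] (m : ℕ) (hm : 1 ≤ m)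
    (a : Fin d → ℤ)
    (S : Finset ι) (κ : ι → Fin d → ℤ) (c : ι → ℂ)
    (h : ∀ p ∈ S, ∀ q ∈ S, p ≠ q → ¬ (m : ℤ) ∣ ∑ j, (κ p - κ q) j * a j) :
    ∑ μ ∈ Finset.Icc 1 m, Complex.normSq (∑ p ∈ S, c p * expo (κ p) (point m a μ)) =
      m * ∑ p ∈ S, Complex.normSq (c p) := by
  have key : ∀ p ∈ S, ∀ q ∈ S,
      ∑ μ ∈ Finset.Icc 1 m, (c p * expo (κ p) (point m a μ)) *
        (starRingEnd ℂ) (c q * expo (κ q) (point m a μ)) =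
      if p = q then (m : ℂ) * (Complex.normSq (c p) : ℂ) else 0 := by
    intro p hp q hq
    have h1 : ∀ μ, (c p * expo (κ p) (point m a μ)) *
        (starRingEnd ℂ) (c q * expo (κ q) (point m a μ)) =
        (c p * (starRingEnd ℂ) (c q)) * expo (κ p - κ q) (point m a μ) := by
      intro μ
      rw [← expo_mul_conj, map_mul]
      ring
    simp only [h1]
    rw [← Finset.mul_sum]
    split_ifs with hpq
    · subst hpq
      rw [sum_expo_point_of_dvd m hm a _ (by simp), Complex.mul_conj, mul_comm]
    · rw [sum_expo_point_of_not_dvd m hm a _ (h p hp q hq hpq), mul_zero]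
  have h2 : ((∑ μ ∈ Finset.Icc 1 m,
      Complex.normSq (∑ p ∈ S, c p * expo (κ p) (point m a μ)) : ℝ) : ℂ) =
      ((m * ∑ p ∈ S, Complex.normSq (c p) : ℝ) : ℂ) := by
    push_cast
    simp only [← Complex.mul_conj, map_sum, Finset.sum_mul_sum]
    rw [Finset.sum_comm, Finset.mul_sum]
    refine Finset.sum_congr rfl fun p hp => ?_
    rw [Finset.sum_comm, Finset.sum_congr rfl (fun q hq => key p hp q hq), Finset.sum_ite_eq,
      if_pos hp, Complex.mul_conj]
  exact_mod_cast h2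

/-! ### Weights localised at a point -/

/-- The univariate trigonometric polynomial `∑_{l < M} β_l e^{2πilt}`. -/
noncomputable def trigSum (M : ℕ) (β : ℕ → ℝ) (t : ℝ) : ℂ :=
  ∑ l ∈ Finset.range M, (β l : ℂ) * unitExp (l * t)

/-- No nonzero vector of the hyperbolic cross lies in the dual lattice. -/
def DualFree {d : ℕ} (m : ℕ) (a : Fin d → ℤ) (L : ℕ) : Prop :=
  ∀ k ∈ hyperbolicCross L d, k ≠ 0 → ¬ (m : ℤ) ∣ ∑ j, k j * a j

/-- Expanded, the product has frequencies p with 0 ≤ p_j < M_j. Two of them differ by less than M_j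
in coordinate j, so the difference lies in the cross. The shift z only contributes unimodular
factors. -/
theorem sum_prod_normSq_trigSum {d : ℕ} {m L : ℕ} (hm : 1 ≤ m) {a : Fin d → ℤ}
    (h : DualFree m a L) (M : Fin d → ℕ) (hM : ∏ j, M j ≤ L) (β : Fin d → ℕ → ℝ)
    (z : Fin d → ℝ) :
    ∑ μ ∈ Finset.Icc 1 m, ∏ j, Complex.normSq (trigSum (M j) (β j) (point m a μ j - z j)) =
      m * ∏ j, ∑ l ∈ Finset.range (M j), β j l ^ 2 := by
  have h1 : ∀ μ, ∏ j, Complex.normSq (trigSum (M j) (β j) (point m a μ j - z j)) =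
      Complex.normSq (∑ p ∈ Fintype.piFinset fun j => Finset.range (M j),
        (∏ j, (β j (p j) : ℂ) * unitExp (-(p j * z j))) *
          expo (fun j => (p j : ℤ)) (point m a μ)) := by
    intro μ
    rw [← map_prod]
    congr 1
    simp only [trigSum]
    rw [Finset.prod_univ_sum]
    refine Finset.sum_congr rfl fun p _ => ?_
    rw [expo_eq_prod, ← Finset.prod_mul_distrib]
    refine Finset.prod_congr rfl fun j _ => ?_
    rw [mul_assoc, ← unitExp_add]
    congr 2
    push_cast
    ring
  simp only [h1]
  rw [sum_normSq_expo_point m hm a, Finset.prod_univ_sum]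
  · congr 1
    refine Finset.sum_congr rfl fun p _ => ?_
    rw [map_prod]
    refine Finset.prod_congr rfl fun j _ => ?_
    rw [map_mul, normSq_unitExp, Complex.normSq_ofReal, mul_one, sq]
  · intro p hp q hq hpq
    refine h _ ?_ ?_
    · have h2 : ∏ j, max |((fun j => (p j : ℤ)) - fun j => (q j : ℤ)) j| 1 ≤ ∏ j, (M j : ℤ) := by
        refine Finset.prod_le_prod (fun j _ => le_trans zero_le_one (le_max_right _ _))
          fun j _ => ?_
        have hp' := Finset.mem_range.1 (Fintype.mem_piFinset.1 hp j)
        have hq' := Finset.mem_range.1 (Fintype.mem_piFinset.1 hq j)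
        simp only [Pi.sub_apply]
        refine max_le (abs_le.2 ⟨?_, ?_⟩) ?_ <;> omega
      exact h2.trans (by exact_mod_cast hM)
    · intro h0
      apply hpq
      funext j
      have := congrFun h0 j
      simp only [Pi.sub_apply, Pi.zero_apply] at this
      omega

/-- Summation by parts. Since β vanishes at 0 and M, the product still has only M frequencies, so
Parseval applies to it with the same M. -/
theorem normSq_unitExp_sub_one_mul_trigSum (M : ℕ) (β : ℕ → ℝ) (h0 : β 0 = 0) (hM : β M = 0)
    (t : ℝ) :
    Complex.normSq (unitExp t - 1) * Complex.normSq (trigSum M β t) =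
      Complex.normSq (trigSum M (fun l => β l - β (l + 1)) t) := by
  have h1 : trigSum M β t =
      ∑ l ∈ Finset.range M, (β (l + 1) : ℂ) * unitExp ((l + 1 : ℕ) * t) := by
    have h2 := Finset.sum_range_succ (fun l => (β l : ℂ) * unitExp (l * t)) M
    rw [Finset.sum_range_succ'] at h2
    simp only [h0, hM, Complex.ofReal_zero, zero_mul, add_zero] at h2
    rw [trigSum, h2]
  have h3 : (unitExp t - 1) * trigSum M β t =
      unitExp t * trigSum M (fun l => β l - β (l + 1)) t := by
    rw [sub_mul, one_mul]
    nth_rewrite 2 [h1]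
    rw [trigSum, trigSum, Finset.mul_sum, Finset.mul_sum, ← Finset.sum_sub_distrib]
    refine Finset.sum_congr rfl fun l _ => ?_
    rw [show ((l + 1 : ℕ) : ℝ) * t = t + l * t by push_cast; ring, unitExp_add]
    push_cast
    ring
  rw [← map_mul, h3, map_mul, normSq_unitExp, one_mul]

/-- The coefficients `l (M - l)`. -/
noncomputable def parabola (M l : ℕ) : ℝ := l * (M - l)

theorem sum_parabola_sq (M : ℕ) :
    ∑ l ∈ Finset.range M, parabola M l ^ 2 = (M : ℝ) * (M ^ 4 - 1) / 30 := by
  -- The upper limit is decoupled from M so that induction applies.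
  have h : ∀ n : ℕ, ∑ l ∈ Finset.range n, parabola M l ^ 2 =
      (M : ℝ) ^ 2 * ((n - 1) * n * (2 * n - 1) / 6) - 2 * M * ((n - 1) * n / 2) ^ 2 +
        (n - 1) * n * (2 * n - 1) * (3 * n ^ 2 - 3 * n - 1) / 30 := by
    intro n
    induction n with
    | zero => simp
    | succ n ih =>
      rw [Finset.sum_range_succ, ih, parabola]
      push_cast
      ring
  rw [h]
  ring

theorem sum_parabola_diff_sq (M : ℕ) :
    ∑ l ∈ Finset.range M, (parabola M l - parabola M (l + 1)) ^ 2 =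
      (M : ℝ) * (M ^ 2 - 1) / 3 := by
  have h : ∀ n : ℕ, ∑ l ∈ Finset.range n, (parabola M l - parabola M (l + 1)) ^ 2 =
      (n : ℝ) * (M - 1) ^ 2 - 4 * (M - 1) * ((n - 1) * n / 2) +
        4 * ((n - 1) * n * (2 * n - 1) / 6) := by
    intro n
    induction n with
    | zero => simp
    | succ n ih =>
      rw [Finset.sum_range_succ, ih, parabola, parabola]
      push_cast
      ring
  rw [h]
  ring

/-- By the closed forms the ratio of the two sums is 10/(M² + 1) for M ≥ 2, and both vanish at M =
1. -/
theorem sq_mul_sum_parabola_diff_sq_le (M : ℕ) (hM : 1 ≤ M) :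
    (M : ℝ) ^ 2 * ∑ l ∈ Finset.range M, (parabola M l - parabola M (l + 1)) ^ 2 ≤
      10 * ∑ l ∈ Finset.range M, parabola M l ^ 2 := by
  rw [sum_parabola_sq, sum_parabola_diff_sq]
  have h1 : (1 : ℝ) ≤ M := by exact_mod_cast hM
  have h2 : (M : ℝ) * (M ^ 4 - 1) / 30 * 10 - M ^ 2 * (M * (M ^ 2 - 1) / 3) =
      M * (M ^ 2 - 1) / 3 := by ring
  have h3 : (0 : ℝ) ≤ M * (M ^ 2 - 1) / 3 := by
    have : (0 : ℝ) ≤ M ^ 2 - 1 := by nlinarith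
    positivity
  linarith

theorem sum_parabola_sq_pos (M : ℕ) (hM : 2 ≤ M) :
    0 < ∑ l ∈ Finset.range M, parabola M l ^ 2 := by
  rw [sum_parabola_sq]
  have h1 : (2 : ℝ) ≤ M := by exact_mod_cast hM
  have : (1 : ℝ) < M ^ 4 := one_lt_pow₀ (by linarith) (by norm_num)
  have : (0 : ℝ) < M ^ 4 - 1 := by linarith
  positivity

/-! ### Empty boxes and dispersion -/

/-- A number of `[0,1)` outside `[x,y)` is far from the midpoint modulo one. -/
theorem four_mul_sq_le_normSq_unitExp_sub_one {x y t : ℝ} (hx : 0 ≤ x) (hxy : x < y) (hy : y < 1)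
    (ht0 : 0 ≤ t) (ht1 : t < 1) (ht : t ∉ Set.Ico x y) :
    4 * (y - x) ^ 2 ≤ Complex.normSq (unitExp (t - (x + y) / 2) - 1) := by
  rw [normSq_unitExp_sub_one]
  set s := t - (x + y) / 2 with hs
  -- The distance from s to the nearest integer is at least half the side; Jordan's inequality for
  -- the sine then gives the bound.
  have habs : (y - x) / 2 ≤ |s| ∧ |s| ≤ 1 - (y - x) / 2 := by
    by_cases h : t < x
    · rw [abs_of_neg (by linarith)]
      constructor <;> linarith
    · have : y ≤ t := by
        by_contra h'
        exact ht ⟨not_lt.1 h, not_le.1 h'⟩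
      rw [abs_of_pos (by linarith)]
      constructor <;> linarith
  have hpi := Real.pi_pos
  have h1 : y - x ≤ Real.sin (Real.pi * |s|) := by
    by_cases h : |s| ≤ 1 / 2
    · have := Real.mul_le_sin (x := Real.pi * |s|) (by positivity) (by nlinarith)
      have h2 : 2 / Real.pi * (Real.pi * |s|) = 2 * |s| := by field_simp
      linarith [habs.1]
    · have := Real.mul_le_sin (x := Real.pi * (1 - |s|))
        (mul_nonneg hpi.le (by linarith [habs.2])) (by nlinarith)
      have h2 : 2 / Real.pi * (Real.pi * (1 - |s|)) = 2 * (1 - |s|) := by field_simp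
      rw [show Real.pi * (1 - |s|) = Real.pi - Real.pi * |s| by ring, Real.sin_pi_sub] at this
      rw [show Real.pi * (1 - |s|) = Real.pi - Real.pi * |s| by ring] at h2
      linarith [habs.2]
  have h3 : Real.sin (Real.pi * s) ^ 2 = Real.sin (Real.pi * |s|) ^ 2 := by
    rcases abs_cases s with ⟨h, _⟩ | ⟨h, _⟩ <;> rw [h]
    rw [mul_neg, Real.sin_neg, neg_sq]
  rw [h3]
  have : (y - x) ^ 2 ≤ Real.sin (Real.pi * |s|) ^ 2 := pow_le_pow_left₀ (by linarith) h1 2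
  linarith

/-- Boxes whose side lengths are large compared to `1 / M j` contain a node. -/
theorem exists_point_mem_box {d : ℕ} (hd : 1 ≤ d) {m L : ℕ} (hm : 1 ≤ m) {a : Fin d → ℤ}
    (h : DualFree m a L) {x y : Fin d → ℝ} (hx : x ∈ unitCube d) (hy : y ∈ unitCube d)
    (hxy : ∀ j, x j < y j) (M : Fin d → ℕ) (hM : ∏ j, M j ≤ L)
    (hMu : ∀ j, 2 * (d : ℝ) ≤ M j * (y j - x j)) :
    (box x y ∩ pointSet m a).Nonempty := by
  by_contra hne
  rw [Set.not_nonempty_iff_eq_empty] at hne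
  have hd' : (1 : ℝ) ≤ d := by exact_mod_cast hd
  have hu : ∀ j, 0 < y j - x j := fun j => by linarith [hxy j]
  have hu1 : ∀ j, y j - x j < 1 := fun j => by
    linarith [(hx j (Set.mem_univ j)).1, (hy j (Set.mem_univ j)).2]
  have hM2 : ∀ j, 2 ≤ M j := fun j => by
    have : (2 : ℝ) ≤ M j := by
      have h0 : (0 : ℝ) ≤ M j := Nat.cast_nonneg _
      nlinarith [hMu j, hu j, hu1 j]
    exact_mod_cast this
  set z : Fin d → ℝ := fun j => (x j + y j) / 2
  set S : Fin d → ℝ := fun j => ∑ l ∈ Finset.range (M j), parabola (M j) l ^ 2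
  set R : Fin d → ℝ := fun j =>
    ∑ l ∈ Finset.range (M j), (parabola (M j) l - parabola (M j) (l + 1)) ^ 2
  set W : ℕ → Fin d → ℝ := fun μ j =>
    Complex.normSq (trigSum (M j) (parabola (M j)) (point m a μ j - z j))
  set D : ℕ → Fin d → ℝ := fun μ j => Complex.normSq (unitExp (point m a μ j - z j) - 1)
  have hS : ∀ j, 0 < S j := fun j => sum_parabola_sq_pos _ (hM2 j)
  have hm0 : (0 : ℝ) < m := by exact_mod_cast hm
  have total : ∑ μ ∈ Finset.Icc 1 m, ∏ j, W μ j = m * ∏ j, S j :=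
    sum_prod_normSq_trigSum hm h M hM (fun j => parabola (M j)) z
  -- Parseval again, with differenced coefficients in coordinate i only.
  have weighted : ∀ i, ∑ μ ∈ Finset.Icc 1 m, D μ i * ∏ j, W μ j =
      m * (R i * ∏ j ∈ Finset.univ.erase i, S j) := by
    intro i
    have h1 := sum_prod_normSq_trigSum hm h M hM
      (fun j => if j = i then fun l => parabola (M j) l - parabola (M j) (l + 1)
        else parabola (M j)) z
    rw [← Finset.mul_prod_erase Finset.univ _ (Finset.mem_univ i), if_pos rfl] at h1
    rw [Finset.prod_congr rfl (g := S) (fun j hj => by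
      rw [if_neg (Finset.ne_of_mem_erase hj)])] at h1
    rw [← h1]
    refine Finset.sum_congr rfl fun μ _ => ?_
    rw [← Finset.mul_prod_erase Finset.univ _ (Finset.mem_univ i),
      ← Finset.mul_prod_erase Finset.univ (fun j => Complex.normSq _) (Finset.mem_univ i),
      if_pos rfl, ← mul_assoc, normSq_unitExp_sub_one_mul_trigSum _ _ (by simp [parabola])
        (by simp [parabola])]
    congr 1
    refine Finset.prod_congr rfl fun j hj => ?_
    rw [if_neg (Finset.ne_of_mem_erase hj)]
  have pointwise : ∀ μ ∈ Finset.Icc 1 m,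
      ∏ j, W μ j ≤ ∑ i, (4 * (y i - x i) ^ 2)⁻¹ * (D μ i * ∏ j, W μ j) := by
    intro μ hμ
    have hW : 0 ≤ ∏ j, W μ j := Finset.prod_nonneg fun j _ => Complex.normSq_nonneg _
    have hout : point m a μ ∉ box x y := fun hmem => by
      have : point m a μ ∈ box x y ∩ pointSet m a :=
        ⟨hmem, μ, (Finset.mem_Icc.1 hμ).1, (Finset.mem_Icc.1 hμ).2, rfl⟩
      rw [hne] at this
      exact this
    obtain ⟨i, hi⟩ : ∃ i, point m a μ i ∉ Set.Ico (x i) (y i) := by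
      by_contra hall
      push Not at hall
      exact hout fun j _ => hall j
    have hDi : 4 * (y i - x i) ^ 2 ≤ D μ i :=
      four_mul_sq_le_normSq_unitExp_sub_one (hx i (Set.mem_univ i)).1 (hxy i)
        (hy i (Set.mem_univ i)).2 (Int.fract_nonneg _) (Int.fract_lt_one _) hi
    have hpos : 0 < 4 * (y i - x i) ^ 2 := by have := hu i; positivity
    refine le_trans ?_ (Finset.single_le_sum
      (f := fun i => (4 * (y i - x i) ^ 2)⁻¹ * (D μ i * ∏ j, W μ j))
      (fun j _ => mul_nonneg (by positivity) (mul_nonneg (Complex.normSq_nonneg _) hW))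
      (Finset.mem_univ i))
    rw [← mul_assoc]
    refine le_mul_of_one_le_left hW ?_
    rw [← div_eq_inv_mul, one_le_div hpos]
    exact hDi
  have hsum := Finset.sum_le_sum pointwise
  rw [total, Finset.sum_comm] at hsum
  -- 10/(4u_i²M_i²) with M_i u_i ≥ 2d.
  have hterm : ∀ i, ∑ μ ∈ Finset.Icc 1 m, (4 * (y i - x i) ^ 2)⁻¹ * (D μ i * ∏ j, W μ j) ≤
      (10 / (16 * (d : ℝ) ^ 2)) * (m * ∏ j, S j) := by
    intro i
    rw [← Finset.mul_sum, weighted, ← Finset.mul_prod_erase Finset.univ S (Finset.mem_univ i)]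
    have hP : 0 < ∏ j ∈ Finset.univ.erase i, S j := Finset.prod_pos fun j _ => hS j
    have hRS : (M i : ℝ) ^ 2 * R i ≤ 10 * S i :=
      sq_mul_sum_parabola_diff_sq_le (M i) (by linarith [hM2 i])
    have hR : 0 ≤ R i := Finset.sum_nonneg fun l _ => sq_nonneg _
    have hsq : 4 * (d : ℝ) ^ 2 ≤ (M i : ℝ) ^ 2 * (y i - x i) ^ 2 := by
      have := pow_le_pow_left₀ (by positivity) (hMu i) 2
      rw [mul_pow, mul_pow] at this
      linarith
    have hui : 0 < (y i - x i) ^ 2 := by have := hu i; positivity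
    have key : (4 * (y i - x i) ^ 2)⁻¹ * R i ≤ 10 / (16 * (d : ℝ) ^ 2) * S i := by
      rw [← div_eq_inv_mul, div_mul_eq_mul_div, div_le_div_iff₀ (by positivity) (by positivity)]
      nlinarith [mul_le_mul_of_nonneg_right hRS hui.le, mul_le_mul_of_nonneg_right hsq hR]
    have := mul_le_mul_of_nonneg_right key (mul_pos hm0 hP).le
    linarith
  have hle := hsum.trans (Finset.sum_le_sum fun i _ => hterm i)
  rw [Finset.sum_const, Finset.card_univ, Fintype.card_fin, nsmul_eq_mul, ← mul_assoc] at hle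
  have hT : 0 < (m : ℝ) * ∏ j, S j := mul_pos hm0 (Finset.prod_pos fun j _ => hS j)
  have hc : (d : ℝ) * (10 / (16 * (d : ℝ) ^ 2)) < 1 := by
    rw [mul_div_assoc', div_lt_one (by positivity)]
    nlinarith
  nlinarith [mul_lt_mul_of_pos_right hc hT]

theorem volume_box {d : ℕ} {x y : Fin d → ℝ} (hxy : ∀ j, x j < y j) :
    (MeasureTheory.volume (box x y)).toReal = ∏ j, (y j - x j) := by
  rw [box, MeasureTheory.volume_pi_pi, ENNReal.toReal_prod]
  refine Finset.prod_congr rfl fun j _ => ?_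
  rw [Real.volume_Ico, ENNReal.toReal_ofReal (by linarith [hxy j])]

theorem disp_pointSet_le {d : ℕ} (hd : 1 ≤ d) {m L : ℕ} (hm : 1 ≤ m) (hL : 1 ≤ L)
    {a : Fin d → ℤ} (h : DualFree m a L) :
    disp (pointSet m a) ≤ (3 * d : ℝ) ^ d / L := by
  have hL0 : (0 : ℝ) < L := by exact_mod_cast hL
  have hd' : (1 : ℝ) ≤ d := by exact_mod_cast hd
  -- Nonnegativity of the bound covers an empty family, whose `sSup` is 0.
  refine Real.sSup_le ?_ (by positivity)
  rintro v ⟨B, ⟨x, hx, y, hy, hxy, rfl⟩, hempty, rfl⟩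
  rw [volume_box hxy]
  by_contra hlt
  rw [not_le] at hlt
  have hu : ∀ j, 0 < y j - x j := fun j => by linarith [hxy j]
  have hu1 : ∀ j, y j - x j < 1 := fun j => by
    linarith [(hx j (Set.mem_univ j)).1, (hy j (Set.mem_univ j)).2]
  set M : Fin d → ℕ := fun j => ⌈2 * (d : ℝ) / (y j - x j)⌉₊
  have hM : ∏ j, M j ≤ L := by
    have h1 : ∏ j, (M j : ℝ) ≤ ∏ j, (3 * d / (y j - x j)) := by
      refine Finset.prod_le_prod (fun j _ => Nat.cast_nonneg _) fun j _ => ?_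
      -- Rounding up costs at most 1 ≤ d/u_j, whence 3d.
      have h2 := (Nat.ceil_lt_add_one
        (div_nonneg (by positivity : (0 : ℝ) ≤ 2 * d) (hu j).le)).le
      refine h2.trans ?_
      rw [div_add_one (hu j).ne', div_le_div_iff_of_pos_right (hu j)]
      linarith [hu1 j]
    have hV : 0 < ∏ j, (y j - x j) := Finset.prod_pos fun j _ => hu j
    rw [Finset.prod_div_distrib, Finset.prod_const, Finset.card_univ, Fintype.card_fin] at h1
    have h3 : (3 * d : ℝ) ^ d / ∏ j, (y j - x j) ≤ L := by
      rw [div_le_iff₀ hV, mul_comm (L : ℝ)]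
      exact ((div_lt_iff₀ hL0).1 hlt).le
    exact_mod_cast h1.trans h3
  obtain ⟨p, hp⟩ := exists_point_mem_box hd hm h hx hy hxy M hM fun j =>
    (div_le_iff₀ (hu j)).1 (Nat.le_ceil _)
  rw [hempty] at hp
  exact hp

/-! ### Exactness excludes dual vectors -/

theorem integral_unitExp_int_mul {n : ℤ} (hn : n ≠ 0) :
    ∫ t in Set.Ico (0 : ℝ) 1, unitExp (n * t) = 0 := by
  rw [MeasureTheory.integral_Ico_eq_integral_Ioc, ← intervalIntegral.integral_of_le zero_le_one]
  have hc : (2 * (Real.pi : ℂ) * Complex.I * n) ≠ 0 :=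
    mul_ne_zero Complex.two_pi_I_ne_zero (by exact_mod_cast hn)
  have h1 : ∀ t : ℝ, unitExp (n * t) = Complex.exp (2 * (Real.pi : ℂ) * Complex.I * n * t) := by
    intro t
    rw [unitExp]
    congr 1
    push_cast
    ring
  simp only [h1]
  rw [integral_exp_mul_complex hc]
  have h2 := h1 1
  rw [mul_one, unitExp_int] at h2
  rw [← h2]
  simp

theorem integral_expo {d : ℕ} {k : Fin d → ℤ} (hk : k ≠ 0) :
    ∫ x in unitCube d, expo k x = 0 := by
  obtain ⟨j, hj⟩ := Function.ne_iff.1 hk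
  rw [unitCube, MeasureTheory.volume_pi, MeasureTheory.Measure.restrict_pi_pi]
  simp only [expo_eq_prod]
  rw [MeasureTheory.integral_fintype_prod_eq_prod (𝕜 := ℂ)
    (fun i (t : ℝ) => unitExp ((k i : ℝ) * t))]
  exact Finset.prod_eq_zero (Finset.mem_univ j) (integral_unitExp_int_mul hj)

theorem expo_mem_trigPolys {d N : ℕ} {k : Fin d → ℤ} (hk : k ∈ hyperbolicCross N d) :
    expo k ∈ trigPolys N d := by
  refine ⟨fun l => if l = k then 1 else 0, ?_⟩
  funext x
  simp [ite_mul, hk]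

/-- An exponential with frequency in the dual lattice is 1 at every node, but its integral is 0 if
the frequency is nonzero. -/
theorem dualFree_of_isExact {d m L : ℕ} (hm : 1 ≤ m) {a : Fin d → ℤ} (h : IsExact m a L) :
    DualFree m a L := by
  intro k hk hk0 hdvd
  have h1 := h _ (expo_mem_trigPolys hk)
  have hm0 : (m : ℂ) ≠ 0 := by exact_mod_cast (show m ≠ 0 by omega)
  have h2 : ∀ x : Fin d → ℝ, expo (-0) x = 1 := fun x => by simp [expo]
  rw [cubature, sum_expo_point_of_dvd m hm a k hdvd, inv_mul_cancel₀ hm0, fourierCoefficient] at h1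
  simp only [h2, mul_one] at h1
  rw [integral_expo hk0] at h1
  exact one_ne_zero h1

/-! ### Counting multipliers modulo a prime -/

theorem abs_le_of_mem_hyperbolicCross {d L : ℕ} {k : Fin d → ℤ} (hk : k ∈ hyperbolicCross L d)
    (j : Fin d) : |k j| ≤ L := by
  have h1 : max |k j| 1 ≤ ∏ i, max |k i| 1 := by
    rw [← Finset.mul_prod_erase Finset.univ (fun i => max |k i| 1) (Finset.mem_univ j)]
    refine le_mul_of_one_le_right (le_trans zero_le_one (le_max_right _ _)) ?_
    exact Finset.prod_induction _ (fun t : ℤ => 1 ≤ t) (fun _ _ => one_le_mul_of_one_le_of_one_le)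
      le_rfl fun i _ => le_max_right _ _
  exact (le_max_left _ _).trans (h1.trans hk)

theorem lt_ncard_hyperbolicCross {d : ℕ} (hd : 1 ≤ d) {L : ℕ} (hL : 1 ≤ L) :
    L < (hyperbolicCross L d).ncard := by
  let f : ℕ → Fin d → ℤ := fun n => Pi.single ⟨0, hd⟩ (n : ℤ)
  have hf : Function.Injective f := fun p q hpq => by
    have := Pi.single_injective _ hpq
    exact_mod_cast this
  have hsub : f '' (Finset.range (L + 1) : Set ℕ) ⊆ hyperbolicCross L d := by
    rintro _ ⟨n, hn, rfl⟩
    have hn' : n ≤ L := by simpa [Nat.lt_succ_iff] using hn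
    show ∏ j, max |f n j| 1 ≤ (L : ℤ)
    rw [Finset.prod_eq_single ⟨0, hd⟩]
    · simp only [f, Pi.single_eq_same, Nat.abs_cast]
      exact max_le (by exact_mod_cast hn') (by exact_mod_cast hL)
    · intro j _ hj
      simp [f, hj]
    · simp
  have h1 := Set.ncard_le_ncard hsub (hyperbolicCross_finite L d)
  rw [Set.ncard_image_of_injective _ hf, Set.ncard_coe_finset, Finset.card_range] at h1
  omega

/-- A polynomial congruence of degree less than `d` has at most `d - 1` solutions modulo a prime
exceeding the coefficients. -/
theorem card_powers_dvd_le {d L p : ℕ} [Fact p.Prime] (hd : 1 ≤ d) (hLp : L < p)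
    {k : Fin d → ℤ} (hk : k ∈ hyperbolicCross L d) (hk0 : k ≠ 0) :
    #{a ∈ Finset.Ico 1 p | (p : ℤ) ∣ ∑ j, k j * powers d a j} ≤ d - 1 := by
  let P : Polynomial (ZMod p) := ∑ j : Fin d, Polynomial.monomial (j : ℕ) ((k j : ℤ) : ZMod p)
  have hP0 : P ≠ 0 := by
    obtain ⟨j, hj⟩ := Function.ne_iff.1 hk0
    intro h0
    have h1 : P.coeff j = ((k j : ℤ) : ZMod p) := by
      simp only [P, Polynomial.finsetSum_coeff, Polynomial.coeff_monomial]
      rw [Finset.sum_eq_single j]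
      · simp
      · intro i _ hij
        rw [if_neg (fun h => hij (Fin.ext h))]
      · simp
    rw [h0, Polynomial.coeff_zero, eq_comm, ZMod.intCast_zmod_eq_zero_iff_dvd] at h1
    exact hj (Int.eq_zero_of_abs_lt_dvd h1
      (lt_of_le_of_lt (abs_le_of_mem_hyperbolicCross hk j) (by exact_mod_cast hLp)))
  have hdeg : P.natDegree ≤ d - 1 := by
    refine Polynomial.natDegree_sum_le_of_forall_le _ _ fun j _ => ?_
    exact (Polynomial.natDegree_monomial_le _).trans (by omega)
  refine le_trans ?_ ((Polynomial.card_roots' P).trans hdeg)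
  refine le_trans ?_ (Multiset.toFinset_card_le P.roots)
  refine Finset.card_le_card_of_injOn (fun a : ℕ => (a : ZMod p)) ?_ ?_
  · intro a ha
    have ha' := (Finset.mem_filter.1 ha).2
    rw [← ZMod.intCast_zmod_eq_zero_iff_dvd] at ha'
    simp only [Finset.mem_coe, Multiset.mem_toFinset, Polynomial.mem_roots hP0, Polynomial.IsRoot]
    rw [← ha']
    simp [P, Polynomial.eval_finsetSum, powers]
  · intro a ha b hb hab
    have ha' := (Finset.mem_Ico.1 (Finset.mem_filter.1 ha).1).2
    have hb' := (Finset.mem_Ico.1 (Finset.mem_filter.1 hb).1).2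
    have := (ZMod.natCast_eq_natCast_iff' a b p).1 hab
    rwa [Nat.mod_eq_of_lt ha', Nat.mod_eq_of_lt hb'] at this

/-- Union bound: the bad multipliers number at most (d - 1)|Γ|, fewer than the p - 1 candidates. -/
theorem exists_dualFree_powers {d L p : ℕ} (hp : p.Prime) (hd : 1 ≤ d) (hLp : L < p)
    (hcard : (d - 1) * (hyperbolicCross L d).ncard + 1 < p) :
    ∃ a : ℕ, 1 ≤ a ∧ a < p ∧ DualFree p (powers d a) L := by
  have := Fact.mk hp
  by_contra! hall
  let G := (hyperbolicCross_finite L d).toFinset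
  have hcover : Finset.Ico 1 p ⊆ (G.erase 0).biUnion fun k =>
      {a ∈ Finset.Ico 1 p | (p : ℤ) ∣ ∑ j, k j * powers d a j} := by
    intro a ha
    obtain ⟨h1, h2⟩ := Finset.mem_Ico.1 ha
    have h3 := hall a h1 h2
    simp only [DualFree, not_forall, not_not] at h3
    obtain ⟨k, hk, hk0, hdvd⟩ := h3
    exact Finset.mem_biUnion.2 ⟨k, Finset.mem_erase.2 ⟨hk0, by simpa [G] using hk⟩,
      Finset.mem_filter.2 ⟨ha, hdvd⟩⟩
  have h1 := (Finset.card_le_card hcover).trans (Finset.card_biUnion_le_card_mul _ _ (d - 1)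
    fun k hk => card_powers_dvd_le hd hLp
      (by simpa [G] using Finset.mem_of_mem_erase hk) (Finset.ne_of_mem_erase hk))
  have h2 : #(G.erase 0) ≤ (hyperbolicCross L d).ncard := by
    rw [Set.ncard_eq_toFinset_card _ (hyperbolicCross_finite L d)]
    exact Finset.card_le_card (Finset.erase_subset _ _)
  have h3 := Nat.mul_le_mul_right (d - 1) h2
  rw [Nat.card_Ico] at h1
  rw [mul_comm] at hcard
  omega

end Korobov

/-- The first part of the conclusion says which constant `C₁` is meant: the one in the dispersion
bound for all Korobov point sets whose cubature formula is exact on `T(L,d)`. The second part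
is the existence of a prime `m` and a multiplier `a` with this same `C₁`. -/
theorem proposition3p1 (d : ℕ) (hd : 2 ≤ d) :
    ∃ C₁ : ℝ, 0 < C₁ ∧
      (∀ (L : ℕ), 2 ≤ L → ∀ (m : ℕ), 1 ≤ m → ∀ (a : Fin d → ℤ),
        Korobov.IsExact m a L → Korobov.disp (Korobov.pointSet m a) ≤ C₁ / (L : ℝ)) ∧
      ∃ C₂ : ℝ, 0 < C₂ ∧
        ∀ (L : ℕ), 2 ≤ L →
          ∃ m : ℕ, m.Prime ∧ (m : ℝ) ≤ C₂ * ((Korobov.hyperbolicCross L d).ncard : ℝ) ∧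
            ∃ a : ℕ, 1 ≤ a ∧ a < m ∧
              Korobov.disp (Korobov.pointSet m (Korobov.powers d a)) ≤ C₁ / (L : ℝ) := by
  have hd1 : 1 ≤ d := by omega
  refine ⟨(3 * d : ℝ) ^ d, by positivity, fun L hL m hm a hex =>
    Korobov.disp_pointSet_le hd1 hm (by omega) (Korobov.dualFree_of_isExact hm hex),
    2 * d, by positivity,
    fun L hL => ?_⟩
  set n := (Korobov.hyperbolicCross L d).ncard with hn
  have hLn : L < n := Korobov.lt_ncard_hyperbolicCross hd1 (by omega)
  -- Bertrand's postulate; the upper bound 2((d - 1)n + 1) ≤ 2dn gives C₂ = 2d.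
  obtain ⟨p, hp, hlt, hle⟩ := Nat.exists_prime_lt_and_le_two_mul ((d - 1) * n + 1) (by omega)
  obtain ⟨e, rfl⟩ : ∃ e, d = e + 1 := ⟨d - 1, by omega⟩
  rw [Nat.add_sub_cancel] at hlt hle
  -- Since d ≥ 2, the prime also exceeds n, hence L.
  have hen : n ≤ e * n := Nat.le_mul_of_pos_left n (by omega)
  obtain ⟨a, ha1, ha, hfree⟩ := Korobov.exists_dualFree_powers (L := L) hp hd1 (by omega)
    (by rw [Nat.add_sub_cancel]; exact hlt)
  refine ⟨p, hp, ?_, a, ha1, ha, Korobov.disp_pointSet_le hd1 hp.one_lt.le (by omega) hfree⟩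
  have h1 : p ≤ 2 * (e + 1) * n := by
    calc p ≤ 2 * (e * n + 1) := hle
      _ ≤ 2 * (e * n + n) := by omega
      _ = 2 * (e + 1) * n := by ring
  exact_mod_cast h1
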